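/- Let $\overline{\mathbb C}=\mathbb C\cup\mathbb C^\infty$, where $\mathbb C^\infty=\{\infty e^{i\theta}:\theta\in\mathbb R\}$ is a circle of points at infinity ($\infty e^{i\theta}=\infty e^{i\theta'}$ if and only if $e^{i\theta}=e^{i\theta'}$). Put $G(z)=\frac{z}{1+|z|}$ for $z\in\mathbb C$ and $G(\infty e^{i\theta})=e^{i\theta}$, and equip $\overline{\mathbb C}$ with the metric $d(z_1,z_2)=|G(z_1)-G(z_2)|$. Let $L\subset\mathbb C$ be a compact set with interior $L^\circ$, and let $z_0\in L^\circ$. Assume that for every boundary point $\zeta\in\partial L$ the segment $[z_0,\zeta]$ satisfies $[z_0,\zeta]\setminus\{\zeta\}\subset L^\circ$. Then a function $f:L\to\overline{\mathbb C}$ is the limit, uniformly on $L$ with respect to $d$, of a sequence of complex polynomials if and only if it is of one of the following two types: (a) (finite type) $f:L\to\overline{\mathbb C}$ is continuous, $f(L^\circ)\subset\mathbb C$, and $f|_{L^\circ}$ is holomorphic; (b) (infinite type) $f$ is continuous, takes values in $\mathbb C^\infty$, and has the form $f(z)=\infty e^{i\theta(z)}$, $z\in L$, for some function $\theta:L\to\mathbb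 R$ that is continuous on $L$ and harmonic in $L^\circ$. -/

import Mathlib

open Filter Topology

/-- The compactification `ℂ ∪ ℂ^∞` of the plane by a circle of points at infinity: a point is
either a complex number or a point at infinity `∞u` in a unimodular direction `u`. -/
inductive CircleCompactification : Type
  | ofComplex (z : ℂ) : CircleCompactification
  | infinity (u : Circle) : CircleCompactification

namespace CircleCompactification

/-- The bijection onto the closed unit disc: `z ↦ z / (1 + |z|)` on `ℂ`, and `∞u ↦ u`. -/
noncomputable def toDisc : CircleCompactification → ℂ
  | ofComplex z => z / ((1 + ‖z‖ : ℝ) : ℂ)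
  | infinity u => (u : ℂ)

theorem norm_toDisc_ofComplex (z : ℂ) : ‖toDisc (ofComplex z)‖ = ‖z‖ / (1 + ‖z‖) := by
  have h : (0 : ℝ) ≤ 1 + ‖z‖ := by positivity
  rw [toDisc, norm_div, Complex.norm_real, Real.norm_of_nonneg h]

theorem norm_toDisc_ofComplex_lt_one (z : ℂ) : ‖toDisc (ofComplex z)‖ < 1 := by
  rw [norm_toDisc_ofComplex, div_lt_one (by positivity)]
  linarith

theorem norm_toDisc_infinity (u : Circle) : ‖toDisc (infinity u)‖ = 1 := by
  exact Circle.norm_coe u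

theorem toDisc_injective : Function.Injective toDisc := by
  rintro (z | u) (w | v) h
  · have hn := congrArg norm h
    rw [norm_toDisc_ofComplex, norm_toDisc_ofComplex,
      div_eq_div_iff (by positivity) (by positivity)] at hn
    have hzw : ‖z‖ = ‖w‖ := by linarith
    have hne : ((1 + ‖w‖ : ℝ) : ℂ) ≠ 0 := by
      exact_mod_cast (by positivity : (1 + ‖w‖ : ℝ) ≠ 0)
    simp only [toDisc] at h
    rw [hzw, div_left_inj' hne] at h
    rw [h]
  · have := norm_toDisc_ofComplex_lt_one z
    rw [h, norm_toDisc_infinity] at this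
    exact absurd this (lt_irrefl _)
  · have := norm_toDisc_ofComplex_lt_one w
    rw [← h, norm_toDisc_infinity] at this
    exact absurd this (lt_irrefl _)
  · exact congrArg infinity (Circle.ext h)

/-- The metric `d(x, y) = |toDisc x - toDisc y|`, induced by the Euclidean metric of the closed
unit disc. -/
noncomputable instance : MetricSpace CircleCompactification :=
  MetricSpace.induced toDisc toDisc_injective inferInstance

theorem dist_eq (x y : CircleCompactification) : dist x y = ‖toDisc x - toDisc y‖ :=
  dist_eq_norm (toDisc x) (toDisc y)

/-- `f : L → ℂ ∪ ℂ^∞` is a uniform limit on `L` of (complex) polynomials, for the metric `d`. -/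
def IsUniformLimitOfPolynomials (L : Set ℂ) (f : L → CircleCompactification) : Prop :=
  ∃ P : ℕ → Polynomial ℂ,
    TendstoUniformly (fun (n : ℕ) (z : L) => ofComplex ((P n).eval (z : ℂ))) f atTop

/-- Finite type: `f` is continuous on `L`, and on the interior of `L` it takes values in `ℂ` and is
holomorphic. -/
def IsFiniteType (L : Set ℂ) (f : L → CircleCompactification) : Prop :=
  Continuous f ∧
    ∃ g : ℂ → ℂ, DifferentiableOn ℂ g (interior L) ∧
      ∀ z : L, (z : ℂ) ∈ interior L → f z = ofComplex (g z)

/-- Infinite type: `f` is continuous and `f(z) = ∞e^{iθ(z)}` on `L`, with `θ` real-valued,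
continuous on `L` and harmonic in the interior of `L`. -/
def IsInfiniteType (L : Set ℂ) (f : L → CircleCompactification) : Prop :=
  Continuous f ∧
    ∃ θ : ℂ → ℝ, ContinuousOn θ L ∧ InnerProductSpace.HarmonicOnNhd θ (interior L) ∧
      ∀ z : L, f z = infinity (Circle.exp (θ z))

end CircleCompactification

/-! Sufficiency: contracting towards `z₀` carries `L` into its interior, and by uniform continuity a
contraction close to the identity moves a continuous map little. So one may approximate data
holomorphic or harmonic in a neighbourhood of `L`, which is star-shaped, and Runge's theorem applies
(`exists_polynomial_near_of_starConvex`). Infinite type reduces to it through `exp (Q + C)`: if `Im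
Q` is close to `θ` and the real constant `C` is large, these values are close to `∞e^{iθ}`.

Necessity: the crux is that the set where a limit is infinite is open in the interior of `L`
(`eventually_norm_eq_one`). Near such a point the reciprocals of the polynomials, rotated, converge
to a holomorphic function with nonnegative real part that vanishes there; by the open mapping
theorem it vanishes identically. As the interior is connected, the limit is finite throughout it or
infinite throughout it. In the finite case Weierstrass' theorem gives holomorphy; in the infinite
case a continuous argument exists on `L` and is locally a uniform limit of imaginary parts of
holomorphic logarithms, hence harmonic (`harmonicAt_arg`). -/

/-! ### Runge's theorem on star-shaped compact sets -/

/-- A function holomorphic on a disc is a uniform limit of polynomials on every smaller disc. -/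
theorem exists_polynomial_near_of_differentiableOn_ball {g : ℂ → ℂ} {c : ℂ} {r R : ℝ} (hrR : r < R)
    (hg : DifferentiableOn ℂ g (Metric.ball c R)) {ε : ℝ} (hε : 0 < ε) :
    ∃ P : Polynomial ℂ, ∀ z ∈ Metric.closedBall c r, ‖P.eval z - g z‖ < ε := by
  rcases lt_or_ge r 0 with hr | hr
  · exact ⟨0, by simp [Metric.closedBall_eq_empty.2 hr]⟩
  obtain ⟨s, hrs, hsR⟩ := exists_between hrR
  lift s to NNReal using hr.trans hrs.le
  have hs0 : 0 < s := by exact_mod_cast hr.trans_lt hrs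
  have hps := (hg.mono (Metric.closedBall_subset_ball hsR)).hasFPowerSeriesOnBall hs0
  obtain ⟨s', hrs', hs's⟩ := exists_between hrs
  lift s' to NNReal using hr.trans hrs'.le
  have hu := hps.tendstoUniformlyOn (r' := s') (by exact_mod_cast hs's)
  obtain ⟨n, hn⟩ := (Metric.tendstoUniformlyOn_iff.1 hu ε hε).exists
  refine ⟨∑ k ∈ Finset.range n, Polynomial.C ((cauchyPowerSeries g c s).coeff k) *
    (Polynomial.X - Polynomial.C c) ^ k, fun z hz => ?_⟩
  have h := hn (z - c) (by
    rw [mem_ball_zero_iff, ← dist_eq_norm]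
    exact (Metric.mem_closedBall.1 hz).trans_lt hrs')
  rw [add_sub_cancel, dist_comm, dist_eq_norm] at h
  refine lt_of_eq_of_lt (congrArg (fun x => ‖x - g z‖) ?_) h
  simp [FormalMultilinearSeries.partialSum, Polynomial.eval_finsetSum, mul_comm]

/-- Membership in the closure of the polynomial functions, in terms of `ε`. -/
theorem mem_topologicalClosure_polynomialFunctions {K : Set ℂ} [CompactSpace K] {G : C(K, ℂ)} :
    G ∈ (polynomialFunctions K).topologicalClosure ↔
      ∀ ε > 0, ∃ P : Polynomial ℂ, ∀ z : K, ‖P.eval (z : ℂ) - G z‖ < ε := by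
  rw [← SetLike.mem_coe, Subalgebra.topologicalClosure_coe, Metric.mem_closure_iff]
  refine forall₂_congr fun ε hε => ?_
  rw [polynomialFunctions_coe]
  simp only [Set.exists_range_iff, ContinuousMap.dist_lt_iff hε]
  refine exists_congr fun P => forall_congr' fun z => ?_
  rw [dist_comm, dist_eq_norm]
  rfl

/-- An analytic map that takes values in a closed subspace near one point of a preconnected set
does so on the whole set. -/
theorem AnalyticOnNhd.mem_submodule_of_preconnected {E : Type*} [NormedAddCommGroup E]
    [NormedSpace ℂ E] (S : Submodule ℂ E) (hS : IsClosed (S : Set E)) {F : ℂ → E} {U : Set ℂ}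
    (hF : AnalyticOnNhd ℂ F U) (hU : IsPreconnected U) {t₀ : ℂ} (ht₀ : t₀ ∈ U)
    (h : ∀ᶠ t in 𝓝 t₀, F t ∈ S) {t : ℂ} (ht : t ∈ U) : F t ∈ S := by
  -- Closedness makes `E ⧸ S` a normed space; the identity theorem is applied to the class of `F t`
  -- in it.
  have : IsClosed (S : Set E) := hS
  have hA : AnalyticOnNhd ℂ (fun t => S.mkQL (F t)) U := fun x hx =>
    (S.mkQL.analyticAt _).comp (hF x hx)
  have := hA.eqOn_zero_of_preconnected_of_eventuallyEq_zero hU ht₀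
    (by filter_upwards [h] with t ht; simpa using ht) ht
  simpa using this

/-- A continuous family `F t` of continuous functions that is pointwise holomorphic in the
parameter is analytic for the uniform norm. -/
theorem analyticAt_continuousMap {K : Type*} [TopologicalSpace K] [CompactSpace K]
    {F : ℂ → C(K, ℂ)} {T : Set ℂ} (hT : IsOpen T) (hF : ContinuousOn F T)
    (hd : ∀ z, DifferentiableOn ℂ (fun t => F t z) T) {t₀ : ℂ} (ht₀ : t₀ ∈ T) :
    AnalyticAt ℂ F t₀ := by
  obtain ⟨R, hR, hRT⟩ := Metric.nhds_basis_closedBall.mem_iff.1 (hT.mem_nhds ht₀)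
  lift R to NNReal using hR.le
  have hci : CircleIntegrable F t₀ R :=
    ((hF.mono hRT).mono Metric.sphere_subset_closedBall).circleIntegrable R.2
  -- The Cauchy integral of the `C(K, ℂ)`-valued map is analytic; evaluating at each `z` and using
  -- the scalar Cauchy formula identifies it with `F`.
  have hps := hasFPowerSeriesOn_cauchy_integral hci (by exact_mod_cast hR)
  refine (hps.congr fun w hw => ?_).analyticAt
  rw [Metric.eball_coe] at hw
  ext z
  have hcauchy := ((hd z).mono hRT).circleIntegral_sub_inv_smul hw
  have hint : CircleIntegrable (fun s => (s - w)⁻¹ • F s) t₀ R := by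
    refine ContinuousOn.circleIntegrable R.2 (ContinuousOn.fun_smul ?_
      ((hF.mono hRT).mono Metric.sphere_subset_closedBall))
    refine ContinuousOn.inv₀ (by fun_prop) fun s hs => sub_ne_zero.2 ?_
    rintro rfl
    exact absurd (Metric.mem_sphere.1 hs) (Metric.mem_ball.1 hw).ne
  have hcomm : (∮ s in C(t₀, R), (s - w)⁻¹ • F s) z = ∮ s in C(t₀, R), (s - w)⁻¹ • F s z := by
    have := (ContinuousMap.evalCLM ℂ z).intervalIntegral_comp_comm hint.out
    simpa [circleIntegral] using this.symm
  rw [ContinuousMap.smul_apply, hcomm, hcauchy, smul_smul, inv_mul_cancel₀, one_smul]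
  simp [Real.pi_ne_zero]

theorem StarConvex.add_real_mul_mem {K : Set ℂ} {z₀ : ℂ} (hK : StarConvex ℝ z₀ K) {z : ℂ}
    (hz : z ∈ K) {t : ℝ} (h0 : 0 ≤ t) (h1 : t ≤ 1) : z₀ + t * (z - z₀) ∈ K := by
  simpa using hK.add_smul_sub_mem hz h0 h1

/-- **Runge's theorem for star-shaped compact sets**: a function holomorphic near a star-shaped
compact set is a uniform limit of polynomials on it. -/
theorem exists_polynomial_near_of_starConvex {K U : Set ℂ} {z₀ : ℂ} (hK : IsCompact K)
    (hz₀ : z₀ ∈ K) (hstar : StarConvex ℝ z₀ K) (hU : IsOpen U) (hKU : K ⊆ U) {g : ℂ → ℂ}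
    (hg : DifferentiableOn ℂ g U) {ε : ℝ} (hε : 0 < ε) :
    ∃ P : Polynomial ℂ, ∀ z ∈ K, ‖P.eval z - g z‖ < ε := by
  classical
  have : CompactSpace K := isCompact_iff_compactSpace.1 hK
  -- The contraction factor `t` is taken complex, so that `t ↦ g (z₀ + t (z - z₀))` is analytic in
  -- `C(K, ℂ)`. For small `t` this function of `z` is holomorphic on a large disc, so its Taylor
  -- polynomials approximate it; the identity theorem carries membership in the closure of the
  -- polynomials along `[0, 1]` to `t = 1`.
  let φ : ℂ → C(K, ℂ) := fun t => ⟨fun z => z₀ + t * (z - z₀), by fun_prop⟩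
  have hφ : Continuous φ :=
    ContinuousMap.continuous_of_continuous_uncurry _ (by unfold φ; dsimp [Function.uncurry]; fun_prop)
  let T : Set ℂ := φ ⁻¹' {p | Set.MapsTo p Set.univ U}
  have hT : IsOpen T :=
    (ContinuousMap.isOpen_setOfPred_mapsTo isCompact_univ hU).preimage hφ
  have hTmem : ∀ t ∈ T, ∀ z : K, z₀ + t * (z - z₀) ∈ U := fun t ht z => ht (Set.mem_univ z)
  have hTI : ∀ t : ℝ, 0 ≤ t → t ≤ 1 → (t : ℂ) ∈ T := fun t h0 h1 z _ =>
    hKU (hstar.add_real_mul_mem z.2 h0 h1)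
  let F : ℂ → C(K, ℂ) := fun t => if h : t ∈ T then
    ⟨fun z => g (z₀ + t * (z - z₀)), hg.continuousOn.comp_continuous (by fun_prop)
      (hTmem t h)⟩ else 0
  have hFapp : ∀ t ∈ T, ∀ z : K, F t z = g (z₀ + t * (z - z₀)) := fun t ht z => by
    simp [F, ht]
  have hFc : ContinuousOn F T := by
    rw [continuousOn_iff_continuous_domRestrict]
    refine ContinuousMap.continuous_of_continuous_uncurry _ ?_
    have : Continuous fun p : T × K => g (z₀ + (p.1 : ℂ) * (p.2 - z₀)) :=
      hg.continuousOn.comp_continuous (by fun_prop) fun p => hTmem _ p.1.2 _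
    exact this.congr fun p => (hFapp _ p.1.2 _).symm
  have hFd : ∀ z, DifferentiableOn ℂ (fun t => F t z) T := fun z => by
    refine DifferentiableOn.congr (f := fun t => g (z₀ + t * (z - z₀))) ?_
      (fun t ht => hFapp t ht z)
    exact hg.comp (by fun_prop) fun t ht => hTmem t ht z
  let I : Set ℂ := (fun t : ℝ => (t : ℂ)) '' Set.Icc 0 1
  have hIT : I ⊆ T := by
    rintro _ ⟨t, ht, rfl⟩
    exact hTI t ht.1 ht.2
  have hIc : IsPreconnected I :=
    isPreconnected_Icc.image _ Complex.continuous_ofReal.continuousOn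
  have h0I : (0 : ℂ) ∈ I := ⟨0, by simp, by simp⟩
  have h1I : (1 : ℂ) ∈ I := ⟨1, by simp, by simp⟩
  let A := (polynomialFunctions K).topologicalClosure
  have hnear : ∀ᶠ t in 𝓝 (0 : ℂ), F t ∈ Subalgebra.toSubmodule A := by
    obtain ⟨ρ, hρ, hρU⟩ := Metric.isOpen_iff.1 hU z₀ (hKU hz₀)
    obtain ⟨r, hr⟩ := hK.isBounded.subset_closedBall z₀
    have hr0 : 0 ≤ r := dist_nonneg.trans (hr hz₀)
    -- Such a `t` maps the disc of radius `r + 1`, larger than one containing `K`, into the disc of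
    -- radius `ρ` on which `g` is holomorphic.
    have hlt : ∀ᶠ t : ℂ in 𝓝 0, ‖t‖ * (r + 1) < ρ := by
      have : Tendsto (fun t : ℂ => ‖t‖ * (r + 1)) (𝓝 0) (𝓝 (‖(0 : ℂ)‖ * (r + 1))) :=
        (by fun_prop : Continuous fun t : ℂ => ‖t‖ * (r + 1)).tendsto 0
      exact this.eventually_lt_const (by simpa)
    filter_upwards [hlt, hT.mem_nhds (hIT h0I)] with t ht htT
    refine mem_topologicalClosure_polynomialFunctions.2 fun δ hδ => ?_
    have hdiff : DifferentiableOn ℂ (fun z => g (z₀ + t * (z - z₀))) (Metric.ball z₀ (r + 1)) := by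
      refine hg.comp (by fun_prop) fun z hz => hρU ?_
      rw [mem_ball_iff_norm] at hz
      rw [mem_ball_iff_norm, add_sub_cancel_left, norm_mul]
      exact (mul_le_mul_of_nonneg_left hz.le (norm_nonneg _)).trans_lt ht
    obtain ⟨P, hP⟩ := exists_polynomial_near_of_differentiableOn_ball (lt_add_one r) hdiff hδ
    exact ⟨P, fun z => by rw [hFapp t htT]; exact hP z (hr z.2)⟩
  have h1 : F 1 ∈ Subalgebra.toSubmodule A :=
    AnalyticOnNhd.mem_submodule_of_preconnected _
      (Subalgebra.isClosed_topologicalClosure _)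
      (fun t ht => analyticAt_continuousMap hT hFc hFd (hIT ht)) hIc h0I hnear h1I
  obtain ⟨P, hP⟩ := mem_topologicalClosure_polynomialFunctions.1 h1 ε hε
  refine ⟨P, fun z hz => ?_⟩
  have := hP ⟨z, hz⟩
  rwa [hFapp 1 (hIT h1I), one_mul, add_sub_cancel] at this

/-! ### Polynomial approximation of harmonic functions -/

/-- Every complex polynomial has a primitive with a prescribed value at a prescribed point. -/
theorem Polynomial.exists_derivative_eq_eval_eq (P : Polynomial ℂ) (c a : ℂ) :
    ∃ Q : Polynomial ℂ, Q.derivative = P ∧ Q.eval c = a := by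
  suffices h : ∃ Q : Polynomial ℂ, Q.derivative = P by
    obtain ⟨Q, hQ⟩ := h
    exact ⟨Q + C (a - Q.eval c), by simp [hQ], by simp⟩
  induction P using Polynomial.induction_on' with
  | add p q hp hq =>
    obtain ⟨p', rfl⟩ := hp
    obtain ⟨q', rfl⟩ := hq
    exact ⟨p' + q', by simp⟩
  | monomial n b =>
    refine ⟨monomial (n + 1) (b / (n + 1)), ?_⟩
    rw [derivative_monomial]
    congr 1
    have : (n + 1 : ℂ) ≠ 0 := by exact_mod_cast n.succ_ne_zero
    simp [div_mul_cancel₀ _ this]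

/-- A function harmonic near a star-shaped compact set is a uniform limit of imaginary parts of
polynomials on it. -/
theorem exists_polynomial_im_near_of_starConvex {K U : Set ℂ} {z₀ : ℂ} (hK : IsCompact K)
    (hz₀ : z₀ ∈ K) (hstar : StarConvex ℝ z₀ K) (hU : IsOpen U) (hKU : K ⊆ U) {θ : ℂ → ℝ}
    (hθ : InnerProductSpace.HarmonicOnNhd θ U) {ε : ℝ} (hε : 0 < ε) :
    ∃ Q : Polynomial ℂ, ∀ z ∈ K, |(Q.eval z).im - θ z| < ε := by
  -- `k = θ_x - i θ_y` is holomorphic and `Re (k dz) = dθ`. A primitive of a polynomial close to `k`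
  -- therefore has real part close to `θ`, by integration along segments from `z₀`, whose length is
  -- at most `r`.
  let k : ℂ → ℂ := fun z => fderiv ℝ θ z 1 - Complex.I * fderiv ℝ θ z Complex.I
  have hk : DifferentiableOn ℂ k U := fun z hz =>
    (HarmonicAt.differentiableAt_complex_partial (hθ z hz)).differentiableWithinAt
  have hkre : ∀ z v, (k z * v).re = fderiv ℝ θ z v := fun z v => by
    have hv : v = v.re • (1 : ℂ) + v.im • Complex.I := by
      apply Complex.ext <;> simp
    conv_rhs => rw [hv, map_add, map_smul, map_smul]
    simp [k]
    ring
  obtain ⟨r, hr⟩ := hK.isBounded.subset_closedBall z₀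
  have hr0 : 0 ≤ r := dist_nonneg.trans (hr hz₀)
  obtain ⟨P, hP⟩ := exists_polynomial_near_of_starConvex hK hz₀ hstar hU hKU hk
    (ε := ε / (r + 1)) (by positivity)
  obtain ⟨Q, hQd, hQ0⟩ := P.exists_derivative_eq_eval_eq z₀ (θ z₀)
  -- The factor `i` turns the real part of `Q` into an imaginary part.
  refine ⟨Polynomial.C Complex.I * Q, fun z hz => ?_⟩
  have hzr : ‖z - z₀‖ ≤ r := by simpa [dist_eq_norm] using hr hz
  let u : ℝ → ℝ := fun t => (Q.eval (z₀ + t * (z - z₀))).re - θ (z₀ + t * (z - z₀))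
  have hu : ∀ t ∈ Set.Icc (0 : ℝ) 1, HasDerivWithinAt u
      (((P.eval (z₀ + t * (z - z₀)) - k (z₀ + t * (z - z₀))) * (z - z₀)).re) (Set.Icc 0 1) t := by
    intro t ht
    have hmem := hstar.add_real_mul_mem hz ht.1 ht.2
    have hline : HasDerivAt (fun t : ℝ => z₀ + (t : ℂ) * (z - z₀)) (z - z₀) t := by
      simpa using ((Complex.ofRealCLM.hasDerivAt (x := t)).mul_const (z - z₀)).const_add z₀
    have h1 : HasDerivAt (fun t : ℝ => Q.eval (z₀ + (t : ℂ) * (z - z₀)))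
        (P.eval (z₀ + t * (z - z₀)) * (z - z₀)) t := by
      have := (Q.hasDerivAt (z₀ + (t : ℂ) * (z - z₀))).comp_of_eq t hline rfl
      rwa [hQd] at this
    have h1' := Complex.reCLM.hasFDerivAt.comp_hasDerivAt t h1
    have h2 : HasDerivAt (fun t : ℝ => θ (z₀ + (t : ℂ) * (z - z₀)))
        (fderiv ℝ θ (z₀ + t * (z - z₀)) (z - z₀)) t :=
      (((hθ _ (hKU hmem)).1.differentiableAt (by norm_num)).hasFDerivAt).comp_hasDerivAt t hline
    rw [sub_mul, Complex.sub_re, hkre]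
    exact (h1'.sub h2).hasDerivWithinAt
  have hbound : ∀ t ∈ Set.Icc (0 : ℝ) 1,
      ‖((P.eval (z₀ + t * (z - z₀)) - k (z₀ + t * (z - z₀))) * (z - z₀)).re‖
        ≤ ε / (r + 1) * r := fun t ht => by
    refine (Complex.abs_re_le_norm _).trans ?_
    rw [norm_mul]
    exact mul_le_mul (hP _ (hstar.add_real_mul_mem hz ht.1 ht.2)).le hzr (norm_nonneg _)
      (by positivity)
  have hmv := (convex_Icc (0 : ℝ) 1).norm_image_sub_le_of_norm_hasDerivWithin_le hu hbound
    (Set.left_mem_Icc.2 zero_le_one) (Set.right_mem_Icc.2 zero_le_one)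
  have hu0 : u 0 = 0 := by simp [u, hQ0]
  have hu1 : u 1 = (Q.eval z).re - θ z := by simp [u]
  rw [hu0, hu1, sub_zero, sub_zero, norm_one, mul_one, Real.norm_eq_abs] at hmv
  have hlt : ε / (r + 1) * r < ε := by
    rw [div_mul_eq_mul_div, div_lt_iff₀ (by positivity)]
    nlinarith
  simpa using hmv.trans_lt hlt

/-! ### Contractions towards the centre -/

section StarShaped

variable {L : Set ℂ} {z₀ : ℂ}

/-- Contracting `L` towards `z₀` moves it into its interior. -/
theorem add_real_mul_mem_interior (hL : IsCompact L) (hz₀ : z₀ ∈ interior L)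
    (hstar : ∀ ζ ∈ frontier L, segment ℝ z₀ ζ \ {ζ} ⊆ interior L) {z : ℂ} (hz : z ∈ L) {t : ℝ}
    (h0 : 0 ≤ t) (h1 : t < 1) : z₀ + t * (z - z₀) ∈ interior L := by
  have hfr : ∀ ζ ∈ frontier L, ∀ s : ℝ, 0 ≤ s → s < 1 → z₀ + s * (ζ - z₀) ∈ interior L := by
    intro ζ hζ s hs0 hs1
    refine hstar ζ hζ ⟨?_, fun h => ?_⟩
    · rw [segment_eq_image']
      exact ⟨s, ⟨hs0, hs1.le⟩, by simp⟩
    · have h' : ((1 - s : ℝ) : ℂ) * (z₀ - ζ) = 0 := by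
        rw [Set.mem_singleton_iff] at h
        push_cast
        linear_combination h
      rcases mul_eq_zero.1 h' with h' | h'
      · exact absurd (Complex.ofReal_eq_zero.1 h') (by linarith)
      · rw [sub_eq_zero.1 h'] at hz₀
        exact hζ.2 hz₀
  rcases eq_or_ne z z₀ with rfl | hne
  · simpa using hz₀
  have hpos : 0 < ‖z - z₀‖ := norm_pos_iff.2 (sub_ne_zero.2 hne)
  obtain ⟨r, hr⟩ := hL.isBounded.subset_closedBall z₀
  -- The hypothesis speaks only of boundary points, so the ray is prolonged beyond `z` until it
  -- leaves `L`; at parameter `S` it is outside the disc of radius `r`. It meets the frontier at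
  -- some `ζ` with parameter `s ≥ 1`, and the point in question is at fraction `t / s < 1` of the
  -- way to `ζ`.
  let S : ℝ := max 1 ((r + 1) / ‖z - z₀‖)
  let ray : Set ℂ := (fun s : ℝ => z₀ + s * (z - z₀)) '' Set.Icc 1 S
  have hray : IsPreconnected ray := isPreconnected_Icc.image _ (by fun_prop)
  have hin : (ray ∩ L).Nonempty := ⟨z, ⟨1, ⟨le_rfl, le_max_left _ _⟩, by simp⟩, hz⟩
  have hout : (ray ∩ Lᶜ).Nonempty := by
    refine ⟨z₀ + S * (z - z₀), ⟨S, ⟨le_max_left _ _, le_rfl⟩, rfl⟩, fun h => ?_⟩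
    have h' := hr h
    have hS : 0 ≤ S := zero_le_one.trans (le_max_left _ _)
    rw [mem_closedBall_iff_norm, add_sub_cancel_left, norm_mul, Complex.norm_real,
      Real.norm_of_nonneg hS] at h'
    have : r + 1 ≤ S * ‖z - z₀‖ := (div_le_iff₀ hpos).1 (le_max_right _ _)
    linarith
  have hmeet : (ray ∩ frontier L).Nonempty := by
    by_contra hempty
    have hdis : ∀ w ∈ ray, w ∉ frontier L := fun w hw hw' => hempty ⟨w, hw, hw'⟩
    have hcase : ∀ w ∈ ray, w ∈ L → w ∈ interior L := fun w hw hwL => by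
      by_contra hwi
      exact hdis w hw ⟨subset_closure hwL, hwi⟩
    obtain ⟨w, -, hwi, hwo⟩ := hray (interior L) Lᶜ isOpen_interior hL.isClosed.isOpen_compl
      (fun w hw => (em (w ∈ L)).imp (hcase w hw) id)
      (hin.imp fun w hw => ⟨hw.1, hcase w hw.1 hw.2⟩) hout
    exact hwo (interior_subset hwi)
  obtain ⟨_, ⟨s, hs, rfl⟩, hζ⟩ := hmeet
  have hs0 : 0 < s := zero_lt_one.trans_le hs.1
  have := hfr _ hζ (t / s) (by positivity) ((div_lt_one hs0).2 (h1.trans_le hs.1))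
  convert this using 1
  have : (s : ℂ) ≠ 0 := by exact_mod_cast hs0.ne'
  push_cast
  field_simp
  ring

theorem starConvex_of_add_real_mul_mem_interior
    (h : ∀ z ∈ L, ∀ t : ℝ, 0 ≤ t → t < 1 → z₀ + t * (z - z₀) ∈ interior L) :
    StarConvex ℝ z₀ L := by
  rw [starConvex_iff_segment_subset]
  intro z hz
  rw [segment_eq_image']
  rintro _ ⟨t, ht, rfl⟩
  rcases ht.2.lt_or_eq with h1 | rfl
  · simpa using interior_subset (h z hz t ht.1 h1)
  · simpa using hz

theorem starConvex_interior_of_add_real_mul_mem_interior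
    (h : ∀ z ∈ L, ∀ t : ℝ, 0 ≤ t → t < 1 → z₀ + t * (z - z₀) ∈ interior L) :
    StarConvex ℝ z₀ (interior L) := by
  rw [starConvex_iff_segment_subset]
  intro z hz
  rw [segment_eq_image']
  rintro _ ⟨t, ht, rfl⟩
  rcases ht.2.lt_or_eq with h1 | rfl
  · simpa using h z (interior_subset hz) t ht.1 h1
  · simpa using hz

/-- The composition of a harmonic function with a holomorphic map is harmonic. -/
theorem InnerProductSpace.HarmonicAt.comp_analyticAt {θ : ℂ → ℝ} {φ : ℂ → ℂ} {z : ℂ}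
    (hθ : HarmonicAt θ (φ z)) (hφ : AnalyticAt ℂ φ z) : HarmonicAt (fun w => θ (φ w)) z := by
  obtain ⟨ε, hε, hball⟩ := Metric.isOpen_iff.1 (isOpen_setOfPred_harmonicAt θ) _ hθ
  obtain ⟨F, hF, hFθ⟩ := HarmonicOnNhd.exists_analyticOnNhd_ball_re_eq fun _ hy => hball hy
  have hFφ : AnalyticAt ℂ (fun w => F (φ w)) z :=
    (hF _ (Metric.mem_ball_self hε)).comp hφ
  refine (harmonicAt_congr_nhds ?_).1 hFφ.harmonicAt_re
  filter_upwards [hφ.continuousAt.preimage_mem_nhds (Metric.ball_mem_nhds _ hε)] with w hw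
  exact hFθ hw

/-- A continuous function on `L` is uniformly close to its composition with a contraction
towards `z₀`. -/
theorem exists_contraction_dist_lt {X : Type*} [PseudoMetricSpace X] (hL : IsCompact L) {f : L → X}
    (hf : Continuous f) {ε : ℝ} (hε : 0 < ε) :
    ∃ t : ℝ, 0 < t ∧ t < 1 ∧ ∀ (z : L) (hz : z₀ + t * ((z : ℂ) - z₀) ∈ L),
      dist (f z) (f ⟨_, hz⟩) < ε := by
  have : CompactSpace L := isCompact_iff_compactSpace.1 hL
  obtain ⟨δ, hδ, hfδ⟩ := Metric.uniformContinuous_iff.1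
    (CompactSpace.uniformContinuous_of_continuous hf) ε hε
  obtain ⟨r, hr⟩ := hL.isBounded.subset_closedBall z₀
  have hev : ∀ᶠ t : ℝ in 𝓝 1, (1 - t) * r < δ := by
    have : Tendsto (fun t : ℝ => (1 - t) * r) (𝓝 1) (𝓝 ((1 - 1) * r)) :=
      (by fun_prop : Continuous fun t : ℝ => (1 - t) * r).tendsto 1
    exact this.eventually_lt_const (by simpa)
  have hev' := (hev.filter_mono (nhdsWithin_le_nhds (s := Set.Iio 1))).and
    (Ioo_mem_nhdsLT (zero_lt_one (α := ℝ)))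
  obtain ⟨t, ht, ht0, ht1⟩ := hev'.exists
  refine ⟨t, ht0, ht1, fun z hz => hfδ ?_⟩
  rw [Subtype.dist_eq, dist_eq_norm]
  have : (z : ℂ) - (z₀ + t * (z - z₀)) = ((1 - t : ℝ) : ℂ) * (z - z₀) := by push_cast; ring
  simp only [this, norm_mul, Complex.norm_real, Real.norm_of_nonneg (sub_nonneg.2 ht1.le)]
  refine (mul_le_mul_of_nonneg_left ?_ (sub_nonneg.2 ht1.le)).trans_lt ht
  simpa [dist_eq_norm] using hr z.2

end StarShaped

/-! ### Both types are uniform limits of polynomials -/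

namespace CircleCompactification

/-- One `‖a - b‖` comes from the numerators, the other from the denominators. This turns Euclidean
approximation into approximation for `d`. -/
theorem dist_ofComplex_le (a b : ℂ) : dist (ofComplex a) (ofComplex b) ≤ 2 * ‖a - b‖ := by
  have ha : ((1 + ‖a‖ : ℝ) : ℂ) ≠ 0 := by exact_mod_cast (by positivity : (1 + ‖a‖ : ℝ) ≠ 0)
  have hb : ((1 + ‖b‖ : ℝ) : ℂ) ≠ 0 := by exact_mod_cast (by positivity : (1 + ‖b‖ : ℝ) ≠ 0)
  have key : toDisc (ofComplex a) - toDisc (ofComplex b) =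
      (a - b) / ((1 + ‖a‖ : ℝ) : ℂ) +
        toDisc (ofComplex b) * (((‖b‖ - ‖a‖ : ℝ) : ℂ) / ((1 + ‖a‖ : ℝ) : ℂ)) := by
    simp only [toDisc]
    field_simp
    push_cast
    ring
  have h1 : (1 : ℝ) ≤ 1 + ‖a‖ := by linarith [norm_nonneg a]
  rw [dist_eq, key]
  refine (norm_add_le _ _).trans ?_
  rw [norm_mul, norm_div, norm_div, Complex.norm_real, Complex.norm_real,
    Real.norm_of_nonneg (zero_le_one.trans h1)]
  have h2 : ‖a - b‖ / (1 + ‖a‖) ≤ ‖a - b‖ := div_le_self (norm_nonneg _) h1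
  have h3 : ‖‖b‖ - ‖a‖‖ / (1 + ‖a‖) ≤ ‖a - b‖ := by
    refine (div_le_self (norm_nonneg _) h1).trans ?_
    rw [norm_sub_rev a b]
    exact abs_norm_sub_norm_le b a
  have h4 := mul_le_mul (norm_toDisc_ofComplex_lt_one b).le h3 (by positivity) zero_le_one
  linarith

theorem dist_infinity_exp_le (a b : ℝ) :
    dist (infinity (Circle.exp a)) (infinity (Circle.exp b)) ≤ |a - b| := by
  rw [dist_eq]
  simp only [toDisc, Circle.coe_exp]
  have h : Complex.exp (a * Complex.I) - Complex.exp (b * Complex.I) =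
      Complex.exp (b * Complex.I) * (Complex.exp (Complex.I * (a - b : ℝ)) - 1) := by
    rw [mul_sub, ← Complex.exp_add, mul_one]
    congr 2
    push_cast
    ring
  rw [h, norm_mul, Complex.norm_exp_ofReal_mul_I, one_mul]
  exact Real.norm_exp_I_mul_ofReal_sub_one_le

/-- `exp w` lies in the direction `e^{i Im w}`, and its distance to the point at infinity in that
direction is exactly `1 / (1 + e^{Re w})`. -/
theorem dist_ofComplex_exp_infinity (w : ℂ) :
    dist (ofComplex (Complex.exp w)) (infinity (Circle.exp w.im)) ≤ Real.exp (-w.re) := by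
  have hn : ‖Complex.exp w‖ = Real.exp w.re := Complex.norm_exp w
  have hw : Complex.exp w = (Real.exp w.re : ℂ) * Complex.exp (w.im * Complex.I) := by
    rw [Complex.ofReal_exp, ← Complex.exp_add, Complex.re_add_im]
  have hne : ((1 + Real.exp w.re : ℝ) : ℂ) ≠ 0 := by
    exact_mod_cast (by positivity : (1 + Real.exp w.re : ℝ) ≠ 0)
  rw [dist_eq]
  simp only [toDisc, Circle.coe_exp, hn]
  have : Complex.exp w / ((1 + Real.exp w.re : ℝ) : ℂ) - Complex.exp (w.im * Complex.I) =
      -(Complex.exp (w.im * Complex.I) / ((1 + Real.exp w.re : ℝ) : ℂ)) := by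
    rw [hw]
    field_simp
    push_cast
    ring
  rw [this, norm_neg, norm_div, Complex.norm_exp_ofReal_mul_I, Complex.norm_real,
    Real.norm_of_nonneg (by positivity), Real.exp_neg, ← one_div]
  exact one_div_le_one_div_of_le (Real.exp_pos _) (by linarith)

theorem isUniformLimitOfPolynomials_iff {L : Set ℂ} {f : L → CircleCompactification} :
    IsUniformLimitOfPolynomials L f ↔
      ∀ ε > 0, ∃ P : Polynomial ℂ, ∀ z : L, dist (f z) (ofComplex (P.eval (z : ℂ))) < ε := by
  constructor
  · rintro ⟨P, hP⟩ ε hε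
    obtain ⟨n, hn⟩ := (Metric.tendstoUniformly_iff.1 hP ε hε).exists
    exact ⟨P n, hn⟩
  · intro h
    choose P hP using fun n : ℕ => h (1 / (n + 1 : ℝ)) (by positivity)
    refine ⟨P, Metric.tendstoUniformly_iff.2 fun ε hε => ?_⟩
    filter_upwards [tendsto_one_div_add_atTop_nhds_zero_nat.eventually_lt_const hε] with n hn z
    exact (hP n z).trans hn

section StarShaped

variable {L : Set ℂ} {z₀ : ℂ} {f : L → CircleCompactification}

/-- Even if `f` is infinite at some boundary points, its contraction is finite and holomorphic near
`L`, so Runge's theorem applies to it. -/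
theorem IsFiniteType.isUniformLimitOfPolynomials (hL : IsCompact L) (hz₀ : z₀ ∈ L)
    (h : ∀ z ∈ L, ∀ t : ℝ, 0 ≤ t → t < 1 → z₀ + t * (z - z₀) ∈ interior L)
    (hf : IsFiniteType L f) : IsUniformLimitOfPolynomials L f := by
  obtain ⟨hfc, g, hg, hfg⟩ := hf
  refine isUniformLimitOfPolynomials_iff.2 fun ε hε => ?_
  obtain ⟨t, ht0, ht1, ht⟩ := exists_contraction_dist_lt (z₀ := z₀) hL hfc (half_pos hε)
  obtain ⟨P, hP⟩ := exists_polynomial_near_of_starConvex hL hz₀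
    (starConvex_of_add_real_mul_mem_interior h)
    (U := (fun z => z₀ + t * (z - z₀)) ⁻¹' interior L)
    (isOpen_interior.preimage (by fun_prop)) (fun z hz => h z hz t ht0.le ht1)
    (g := fun z => g (z₀ + t * (z - z₀))) (hg.comp (by fun_prop) fun z hz => hz)
    (ε := ε / 4) (by positivity)
  refine ⟨P, fun z => ?_⟩
  have hin := h z z.2 t ht0.le ht1
  refine (dist_triangle _ (f ⟨_, interior_subset hin⟩) _).trans_lt ?_
  have h1 := ht z (interior_subset hin)
  have h2 := hP z z.2
  have h3 := dist_ofComplex_le (g (z₀ + t * (z - z₀))) (P.eval (z : ℂ))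
  rw [norm_sub_rev] at h3
  rw [hfg ⟨_, interior_subset hin⟩ hin] at h1 ⊢
  linarith

theorem IsInfiniteType.isUniformLimitOfPolynomials (hL : IsCompact L) (hz₀ : z₀ ∈ L)
    (h : ∀ z ∈ L, ∀ t : ℝ, 0 ≤ t → t < 1 → z₀ + t * (z - z₀) ∈ interior L)
    (hf : IsInfiniteType L f) : IsUniformLimitOfPolynomials L f := by
  obtain ⟨-, θ, hθc, hθ, hfθ⟩ := hf
  refine isUniformLimitOfPolynomials_iff.2 fun ε hε => ?_
  have hstar := starConvex_of_add_real_mul_mem_interior h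
  obtain ⟨t, ht0, ht1, ht⟩ := exists_contraction_dist_lt (z₀ := z₀) hL
    (continuousOn_iff_continuous_domRestrict.1 hθc) (ε := ε / 4) (by positivity)
  obtain ⟨Q, hQ⟩ := exists_polynomial_im_near_of_starConvex hL hz₀ hstar
    (U := (fun z => z₀ + t * (z - z₀)) ⁻¹' interior L)
    (isOpen_interior.preimage (by fun_prop)) (fun z hz => h z hz t ht0.le ht1)
    (θ := fun z => θ (z₀ + t * (z - z₀)))
    (fun z hz => (hθ _ hz).comp_analyticAt (φ := fun z => z₀ + t * (z - z₀)) (by fun_prop))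
    (ε := ε / 4) (by positivity)
  -- As `|Q| ≤ M` on `L`, adding the real constant `M + N` makes the real part at least `N` and
  -- leaves the imaginary part unchanged. The exponential is entire, so it is itself approximated by
  -- a polynomial.
  obtain ⟨M, hM⟩ := hL.exists_bound_of_continuousOn (f := fun z => Q.eval z) (by fun_prop)
  obtain ⟨N, hN⟩ := (Real.tendsto_exp_neg_atTop_nhds_zero.eventually_lt_const
    (by positivity : 0 < ε / 4)).exists
  obtain ⟨P, hP⟩ := exists_polynomial_near_of_starConvex hL hz₀ hstar isOpen_univ
    (Set.subset_univ L) (g := fun z => Complex.exp (Q.eval z + (M + N : ℝ)))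
    (Differentiable.differentiableOn (by fun_prop)) (ε := ε / 8) (by positivity)
  refine ⟨P, fun z => ?_⟩
  have hin := h z z.2 t ht0.le ht1
  have h1 : |θ z - θ (z₀ + t * (z - z₀))| < ε / 4 := ht z (interior_subset hin)
  have h2 := hQ z z.2
  set w := Q.eval (z : ℂ) + (M + N : ℝ) with hw
  have him : w.im = (Q.eval (z : ℂ)).im := by simp [w]
  have hre : N ≤ w.re := by
    have := (abs_le.1 ((Complex.abs_re_le_norm _).trans (hM z z.2))).1
    simp only [w, Complex.add_re, Complex.ofReal_re]
    linarith
  have h3 := dist_ofComplex_exp_infinity w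
  have h4 : Real.exp (-w.re) ≤ Real.exp (-N) := Real.exp_le_exp.2 (by linarith)
  have h5 := dist_ofComplex_le (Complex.exp w) (P.eval (z : ℂ))
  have h6 := hP z z.2
  rw [norm_sub_rev] at h5
  have h7 : dist (f z) (infinity (Circle.exp w.im)) < ε / 2 := by
    rw [hfθ, him]
    refine (dist_infinity_exp_le _ _).trans_lt ?_
    rw [abs_lt] at h1 h2 ⊢
    constructor <;> linarith [h1.1, h1.2, h2.1, h2.2]
  have h8 := dist_triangle4 (f z) (infinity (Circle.exp w.im)) (ofComplex (Complex.exp w))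
    (ofComplex (P.eval (z : ℂ)))
  rw [dist_comm (infinity _)] at h8
  linarith

end StarShaped

end CircleCompactification

/-! ### Limits of imaginary parts, continuous arguments, localisation -/

/-- A locally uniform limit of imaginary parts of holomorphic functions is harmonic. -/
theorem harmonicAt_of_tendstoUniformlyOn_im {h : ℕ → ℂ → ℂ} {β : ℂ → ℝ} {c : ℂ} {R : ℝ}
    (hR : 0 < R) (hh : ∀ᶠ n in atTop, DifferentiableOn ℂ (h n) (Metric.ball c R))
    (hβ : TendstoUniformlyOn (fun n z => (h n z).im) β atTop (Metric.ball c R)) :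
    InnerProductSpace.HarmonicAt β c := by
  -- The real parts of `h n` may drift by constants, so values are normalised at `c`.
  -- Borel–Carathéodory then bounds differences of the `k n` on the half ball by their imaginary
  -- parts.
  let k : ℕ → ℂ → ℂ := fun n z => h n z - h n c
  have hsub : Metric.ball c (R / 2) ⊆ Metric.ball c R := Metric.ball_subset_ball (by linarith)
  have hcR : c ∈ Metric.ball c R := Metric.mem_ball_self hR
  have hc2 : c ∈ Metric.ball c (R / 2) := Metric.mem_ball_self (half_pos hR)
  have hcauchy : UniformCauchySeqOn k atTop (Metric.ball c (R / 2)) := by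
    rw [Metric.uniformCauchySeqOn_iff]
    intro ε hε
    obtain ⟨N, hN⟩ := Metric.uniformCauchySeqOn_iff.1 hβ.uniformCauchySeqOn (ε / 8)
      (by positivity)
    obtain ⟨N', hN'⟩ := eventually_atTop.1 hh
    refine ⟨max N N', fun m hm n hn z hz => ?_⟩
    have hmn := hN m ((le_max_left _ _).trans hm) n ((le_max_left _ _).trans hn)
    let D : ℂ → ℂ := fun w => -Complex.I * (k m (c + w) - k n (c + w))
    have hD : DifferentiableOn ℂ D (Metric.ball 0 R) := by
      have hmap : Set.MapsTo (fun w => c + w) (Metric.ball 0 R) (Metric.ball c R) := fun w hw => by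
        simpa [mem_ball_iff_norm] using hw
      have hm' := (hN' m ((le_max_right _ _).trans hm)).comp (by fun_prop) hmap
      have hn' := (hN' n ((le_max_right _ _).trans hn)).comp (by fun_prop) hmap
      exact ((hm'.sub_const _).sub (hn'.sub_const _)).const_mul _
    have hDre : Set.MapsTo D (Metric.ball 0 R) {z | z.re ≤ ε / 4} := fun w hw => by
      have h1 := abs_lt.1 (hmn (c + w) (by simpa [mem_ball_iff_norm] using hw))
      have h2 := abs_lt.1 (hmn c hcR)
      have : (D w).re = ((h m (c + w)).im - (h n (c + w)).im) - ((h m c).im - (h n c).im) := by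
        simp [D, k]
        ring
      change (D w).re ≤ ε / 4
      rw [this]
      linarith [h1.2, h2.1]
    have hz' : ‖z - c‖ < R / 2 := mem_ball_iff_norm.1 hz
    have hb := Complex.borelCaratheodory_zero (z := z - c) (by positivity) hD hDre hR
      (by rw [mem_ball_zero_iff]; linarith) (by simp [D, k])
    have hDz : ‖D (z - c)‖ = dist (k m z) (k n z) := by
      simp [D, dist_eq_norm]
    rw [← hDz]
    refine hb.trans_lt ?_
    rw [div_lt_iff₀ (by linarith)]
    nlinarith [norm_nonneg (z - c)]
  choose! K hK using fun z (hz : z ∈ Metric.ball c (R / 2)) =>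
    cauchySeq_tendsto_of_complete (hcauchy.cauchySeq hz)
  have hunif := hcauchy.tendstoUniformlyOn_of_tendsto hK
  have hKd : DifferentiableOn ℂ K (Metric.ball c (R / 2)) :=
    hunif.tendstoLocallyUniformlyOn.differentiableOn
      (hh.mono fun n hn => (hn.mono hsub).sub_const _) Metric.isOpen_ball
  have hKa : AnalyticAt ℂ (fun z => K z + Complex.I * β c) c :=
    (hKd.analyticAt (Metric.ball_mem_nhds _ (half_pos hR))).add analyticAt_const
  refine (InnerProductSpace.harmonicAt_congr_nhds ?_).1 hKa.harmonicAt_im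
  filter_upwards [Metric.ball_mem_nhds c (half_pos hR)] with z hz
  have h1 : Tendsto (fun n => (k n z).im) atTop (𝓝 (K z).im) :=
    (Complex.continuous_im.tendsto _).comp (hK z hz)
  have h2 : Tendsto (fun n => (k n z).im) atTop (𝓝 (β z - β c)) := by
    simpa [k] using (hβ.tendsto_at (hsub hz)).sub (hβ.tendsto_at hcR)
  have := tendsto_nhds_unique h1 h2
  simp [this]

/-- A continuous unimodular function on a star-shaped compact set has a continuous argument. -/
theorem StarConvex.exists_continuousOn_arg {L : Set ℂ} {z₀ : ℂ} (hL : IsCompact L)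
    (hz₀ : z₀ ∈ L) (hstar : StarConvex ℝ z₀ L) {F : ℂ → ℂ} (hF : ContinuousOn F L)
    (hF1 : ∀ z ∈ L, ‖F z‖ = 1) :
    ∃ θ : ℂ → ℝ, ContinuousOn θ L ∧ ∀ z ∈ L, F z = Complex.exp (θ z * Complex.I) := by
  have hexp : ∀ w : ℂ, ‖w‖ = 1 → Complex.exp ((Complex.log w).im * Complex.I) = w := fun w hw => by
    have := Complex.norm_mul_exp_arg_mul_I w
    rwa [hw, Complex.ofReal_one, one_mul, ← Complex.log_im] at this
  obtain ⟨δ, hδ, hFδ⟩ := Metric.uniformContinuousOn_iff.1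
    (hL.uniformContinuousOn_of_continuous hF) 1 one_pos
  obtain ⟨r, hr⟩ := hL.isBounded.subset_closedBall z₀
  obtain ⟨N, hN⟩ := exists_nat_gt (r / δ)
  have hr0 : 0 ≤ r := dist_nonneg.trans (hr hz₀)
  have hNpos : (0 : ℝ) < N := (by positivity : 0 ≤ r / δ).trans_lt hN
  -- Each segment from `z₀` is cut into `N` steps shorter than `δ`. Consecutive values of `F` then
  -- have quotient within distance 1 of 1, in the slit plane where the principal argument is
  -- continuous; the arguments of the quotients add up to the desired one.
  let a : ℕ → ℂ → ℂ := fun k z => F (z₀ + ((k / N : ℝ) : ℂ) * (z - z₀))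
  have hmem : ∀ k ≤ N, ∀ z ∈ L, z₀ + ((k / N : ℝ) : ℂ) * (z - z₀) ∈ L := fun k hk z hz =>
    hstar.add_real_mul_mem hz (by positivity)
      ((div_le_one hNpos).2 (by exact_mod_cast hk))
  have ha1 : ∀ k ≤ N, ∀ z ∈ L, ‖a k z‖ = 1 := fun k hk z hz => hF1 _ (hmem k hk z hz)
  have hac : ∀ k ≤ N, ContinuousOn (a k) L := fun k hk =>
    hF.comp (by fun_prop) fun z hz => hmem k hk z hz
  have hane : ∀ k ≤ N, ∀ z ∈ L, a k z ≠ 0 := fun k hk z hz =>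
    norm_ne_zero_iff.1 (by rw [ha1 k hk z hz]; exact one_ne_zero)
  have hslit : ∀ k < N, ∀ z ∈ L, a (k + 1) z / a k z ∈ Complex.slitPlane := by
    intro k hk z hz
    have hd : dist (a (k + 1) z) (a k z) < 1 := by
      refine hFδ _ (hmem (k + 1) hk z hz) _ (hmem k hk.le z hz) ?_
      have : z₀ + (((k + 1 : ℕ) / N : ℝ) : ℂ) * (z - z₀) - (z₀ + ((k / N : ℝ) : ℂ) * (z - z₀)) =
          ((1 / N : ℝ) : ℂ) * (z - z₀) := by
        push_cast
        ring
      rw [dist_eq_norm, this, norm_mul, Complex.norm_real, Real.norm_of_nonneg (by positivity)]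
      have hzr : ‖z - z₀‖ ≤ r := by simpa [dist_eq_norm] using hr hz
      rw [div_lt_iff₀ hδ] at hN
      rw [one_div, inv_mul_lt_iff₀ hNpos]
      exact hzr.trans_lt hN
    have hq : ‖a (k + 1) z / a k z - 1‖ < 1 := by
      rw [div_sub_one (hane k hk.le z hz), norm_div, ha1 k hk.le z hz, div_one, ← dist_eq_norm]
      exact hd
    simpa using Complex.mem_slitPlane_of_norm_lt_one hq
  let θ : ℕ → ℂ → ℝ := fun m z => (Complex.log (F z₀)).im +
    ∑ k ∈ Finset.range m, (Complex.log (a (k + 1) z / a k z)).im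
  have hθ : ∀ m ≤ N, ∀ z ∈ L, a m z = Complex.exp (θ m z * Complex.I) := by
    intro m
    induction m with
    | zero =>
      intro _ z hz
      simpa [θ, a] using (hexp _ (hF1 z₀ hz₀)).symm
    | succ m ih =>
      intro hm z hz
      have hm' : m ≤ N := (Nat.le_succ m).trans hm
      have hsucc : θ (m + 1) z = θ m z + (Complex.log (a (m + 1) z / a m z)).im := by
        simp only [θ, Finset.sum_range_succ, add_assoc]
      rw [hsucc, Complex.ofReal_add, add_mul, Complex.exp_add, ← ih hm' z hz,
        hexp _ (by rw [norm_div, ha1 _ hm z hz, ha1 _ hm' z hz, div_one]),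
        mul_div_cancel₀ _ (hane m hm' z hz)]
  refine ⟨θ N, ?_, fun z hz => ?_⟩
  · refine continuousOn_const.add (continuousOn_finsetSum _ fun k hk => ?_)
    have hk' := Finset.mem_range.1 hk
    exact Complex.continuous_im.comp_continuousOn
      (((hac (k + 1) hk').div (hac k hk'.le) (hane k hk'.le)).clog (hslit k hk'))
  · have := hθ N le_rfl z hz
    simpa only [a, div_self hNpos.ne', Complex.ofReal_one, one_mul, add_sub_cancel] using this

/-- Localisation of uniform convergence, composed with a function continuous near a value of the
limit. -/
theorem TendstoUniformlyOn.exists_ball_comp {p : ℕ → ℂ → ℂ} {F : ℂ → ℂ} {L W : Set ℂ}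
    (hp : TendstoUniformlyOn p F atTop L) (hF : ContinuousOn F L) {c : ℂ} (hL : L ∈ 𝓝 c)
    (hW : W ∈ 𝓝 c) {r : ℝ} (hr : 0 < r) {J : ℂ → ℂ}
    (hJ : ContinuousOn J (Metric.closedBall (F c) r)) :
    ∃ R > 0, Metric.ball c R ⊆ L ∧ Metric.ball c R ⊆ W ∧
      (∀ z ∈ Metric.ball c R, F z ∈ Metric.closedBall (F c) r) ∧
      (∀ᶠ n in atTop, ∀ z ∈ Metric.ball c R, p n z ∈ Metric.closedBall (F c) r) ∧
      TendstoUniformlyOn (fun n z => J (p n z)) (fun z => J (F z)) atTop (Metric.ball c R) := by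
  -- Half of `r` is for the variation of `F`, half for the error of `p n`; `J` is uniformly
  -- continuous on the compact ball.
  have hFc : F ⁻¹' Metric.ball (F c) (r / 2) ∈ 𝓝 c :=
    (hF.continuousAt hL).preimage_mem_nhds (Metric.ball_mem_nhds _ (half_pos hr))
  obtain ⟨R, hR, hball⟩ := Metric.mem_nhds_iff.1 (inter_mem (inter_mem hL hW) hFc)
  have hBL : Metric.ball c R ⊆ L := fun z hz => (hball hz).1.1
  have h1 : ∀ z ∈ Metric.ball c R, F z ∈ Metric.closedBall (F c) r := fun z hz => by
    have := Metric.mem_ball.1 (hball hz).2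
    rw [Metric.mem_closedBall]
    linarith
  have h2 : ∀ᶠ n in atTop, ∀ z ∈ Metric.ball c R, p n z ∈ Metric.closedBall (F c) r := by
    filter_upwards [Metric.tendstoUniformlyOn_iff.1 hp (r / 2) (half_pos hr)] with n hn z hz
    have h3 := Metric.mem_ball.1 (hball hz).2
    have h4 := hn z (hBL hz)
    have h5 := dist_triangle_left (p n z) (F c) (F z)
    rw [Metric.mem_closedBall]
    linarith
  exact ⟨R, hR, hBL, fun z hz => (hball hz).1.2, h1, h2,
    UniformContinuousOn.comp_tendstoUniformlyOn_eventually h2 h1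
      ((isCompact_closedBall _ _).uniformContinuousOn_of_continuous hJ) (hp.mono hBL)⟩

/-! ### Uniform limits of polynomials are of one of the two types -/

namespace CircleCompactification

/-- The map `w ↦ w / (1 - |w|)` inverts `toDisc` on the open disc; through it convergence in the
disc gives back the polynomials themselves. -/
theorem toDisc_ofComplex_div_one_sub_norm (z : ℂ) :
    toDisc (ofComplex z) / ((1 - ‖toDisc (ofComplex z)‖ : ℝ) : ℂ) = z := by
  have h : ((1 + ‖z‖ : ℝ) : ℂ) ≠ 0 := by exact_mod_cast (by positivity : (1 + ‖z‖ : ℝ) ≠ 0)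
  have h2 : 1 - ‖z‖ / (1 + ‖z‖) = (1 + ‖z‖)⁻¹ := by
    field_simp
    ring
  rw [norm_toDisc_ofComplex, h2]
  simp only [toDisc]
  rw [Complex.ofReal_inv, div_inv_eq_mul, div_mul_cancel₀ _ h]

theorem norm_toDisc_le_one : ∀ x : CircleCompactification, ‖toDisc x‖ ≤ 1
  | ofComplex z => (norm_toDisc_ofComplex_lt_one z).le
  | infinity u => (norm_toDisc_infinity u).le

theorem eq_ofComplex_of_norm_toDisc_lt_one {x : CircleCompactification} (h : ‖toDisc x‖ < 1) :
    x = ofComplex (toDisc x / ((1 - ‖toDisc x‖ : ℝ) : ℂ)) := by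
  cases x with
  | ofComplex z => rw [toDisc_ofComplex_div_one_sub_norm]
  | infinity u => exact absurd (norm_toDisc_infinity u) h.ne

section PolynomialLimit

variable {P : ℕ → Polynomial ℂ} {F : ℂ → ℂ} {L : Set ℂ} {c : ℂ}

/-- The limit is holomorphic at the points where it is finite. -/
theorem differentiableAt_of_norm_lt_one
    (hP : TendstoUniformlyOn (fun n z => toDisc (ofComplex ((P n).eval z))) F atTop L)
    (hF : ContinuousOn F L) (hL : L ∈ 𝓝 c) (h1 : ‖F c‖ < 1) :
    DifferentiableAt ℂ (fun z => F z / ((1 - ‖F z‖ : ℝ) : ℂ)) c := by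
  -- This radius keeps the closed ball inside the open unit disc, where the inverse of `toDisc` is
  -- continuous.
  have hJ : ContinuousOn (fun w : ℂ => w / ((1 - ‖w‖ : ℝ) : ℂ))
      (Metric.closedBall (F c) ((1 - ‖F c‖) / 2)) := by
    refine continuousOn_id.div (by fun_prop) fun w hw => ?_
    have h2 : ‖w - F c‖ ≤ (1 - ‖F c‖) / 2 := by simpa [dist_eq_norm] using hw
    have h3 := norm_sub_norm_le w (F c)
    exact_mod_cast (by linarith : (0 : ℝ) < 1 - ‖w‖).ne'
  obtain ⟨R, hR, -, -, -, -, hlim⟩ := hP.exists_ball_comp hF hL hL (by linarith) hJ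
  simp only [toDisc_ofComplex_div_one_sub_norm] at hlim
  exact (hlim.tendstoLocallyUniformlyOn.differentiableOn
    (Eventually.of_forall fun n => (P n).differentiable.differentiableOn)
    Metric.isOpen_ball).differentiableAt (Metric.ball_mem_nhds _ hR)

/-- The set of points where the limit is infinite is open. -/
theorem eventually_norm_eq_one
    (hP : TendstoUniformlyOn (fun n z => toDisc (ofComplex ((P n).eval z))) F atTop L)
    (hF : ContinuousOn F L) (hF1 : ∀ z ∈ L, ‖F z‖ ≤ 1) (hL : L ∈ 𝓝 c) (h1 : ‖F c‖ = 1) :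
    ∀ᶠ z in 𝓝 c, ‖F z‖ = 1 := by
  have hne : ∀ w ∈ Metric.closedBall (F c) (1 / 2), w ≠ 0 := by
    rintro w hw rfl
    rw [mem_closedBall_iff_norm, zero_sub, norm_neg, h1] at hw
    norm_num at hw
  -- `J` is chosen so that `J (toDisc p) = F c / p`: a reciprocal, continuous up to the unit circle
  -- and vanishing there. The rotation by `F c` makes its real part nonnegative near `F c` within
  -- the closed unit disc.
  let J : ℂ → ℂ := fun w => ((1 - ‖w‖ : ℝ) : ℂ) * (F c / w)
  have hJ : ContinuousOn J (Metric.closedBall (F c) (1 / 2)) :=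
    ContinuousOn.mul (by fun_prop) (continuousOn_const.div continuousOn_id hne)
  obtain ⟨R, hR, hBL, -, hFB, hPB, hlim⟩ := hP.exists_ball_comp hF hL hL one_half_pos hJ
  have hJP : ∀ z : ℂ, J (toDisc (ofComplex z)) = F c / z := fun z => by
    conv_rhs => rw [← toDisc_ofComplex_div_one_sub_norm z]
    simp only [J]
    rw [div_div_eq_mul_div, mul_comm, mul_div_right_comm]
  simp only [hJP] at hlim
  have hd : DifferentiableOn ℂ (fun z => J (F z)) (Metric.ball c R) := by
    refine hlim.tendstoLocallyUniformlyOn.differentiableOn ?_ Metric.isOpen_ball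
    filter_upwards [hPB] with n hn
    refine (differentiableOn_const _).div (P n).differentiable.differentiableOn fun z hz h0 => ?_
    exact hne _ (hn z hz) (by simp [h0, toDisc])
  have hre : ∀ z ∈ Metric.ball c R, 0 ≤ (J (F z)).re := fun z hz => by
    have hw := hFB z hz
    rw [mem_closedBall_iff_norm] at hw
    have hdiv : 0 ≤ (F c / F z).re := by
      have e1 : ‖F c‖ ^ 2 = 1 := by rw [h1, one_pow]
      have e2 : ‖F z - F c‖ ^ 2 ≤ (1 / 2) ^ 2 := pow_le_pow_left₀ (norm_nonneg _) hw 2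
      rw [Complex.sq_norm, Complex.normSq_apply] at e1 e2
      simp only [Complex.sub_re, Complex.sub_im] at e2
      rw [Complex.div_re, ← add_div]
      refine div_nonneg ?_ (Complex.normSq_nonneg _)
      nlinarith [mul_self_nonneg (F z).re, mul_self_nonneg (F z).im]
    simp only [J, Complex.re_ofReal_mul]
    exact mul_nonneg (sub_nonneg.2 (hF1 z (hBL hz))) hdiv
  have hJc : J (F c) = 0 := by simp [J, h1]
  have hcB : c ∈ Metric.ball c R := Metric.mem_ball_self hR
  filter_upwards [Metric.ball_mem_nhds c hR] with z hz
  suffices hJz : J (F z) = 0 by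
    rcases mul_eq_zero.1 hJz with h | h
    · linarith [Complex.ofReal_eq_zero.1 h]
    · rcases div_eq_zero_iff.1 h with h | h
      · rw [h, norm_zero] at h1
        exact absurd h1 zero_ne_one
      · exact absurd h (hne _ (hFB z hz))
  rcases (hd.analyticOnNhd Metric.isOpen_ball).is_constant_or_isOpen
    (convex_ball c R).isPreconnected with ⟨w, hw⟩ | hopen
  · rw [hw z hz, ← hw c hcB, hJc]
  -- An open image containing `0` would contain the value `-δ/2`, of negative real part.
  · obtain ⟨δ, hδ, hsub⟩ := Metric.isOpen_iff.1 (hopen _ subset_rfl Metric.isOpen_ball) 0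
      ⟨c, hcB, hJc⟩
    obtain ⟨y, hy, hyJ⟩ := hsub (show (-(δ / 2 : ℝ) : ℂ) ∈ Metric.ball 0 δ by
      rw [mem_ball_zero_iff, norm_neg, Complex.norm_real, Real.norm_of_nonneg (by positivity)]
      linarith)
    have h := hre y hy
    rw [show J (F y) = _ from hyJ, Complex.neg_re, Complex.ofReal_re] at h
    linarith

/-- Where the limit is infinite, any continuous determination of its argument is harmonic. -/
theorem harmonicAt_arg
    (hP : TendstoUniformlyOn (fun n z => toDisc (ofComplex ((P n).eval z))) F atTop L)
    (hF : ContinuousOn F L) (hL : L ∈ 𝓝 c) {θ : ℂ → ℝ} (hθ : ContinuousOn θ L)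
    (hFθ : ∀ z ∈ L, F z = Complex.exp (θ z * Complex.I)) :
    InnerProductSpace.HarmonicAt θ c := by
  have hcL : c ∈ L := mem_of_mem_nhds hL
  have h1 : ‖F c‖ = 1 := by rw [hFθ c hcL, Complex.norm_exp_ofReal_mul_I]
  have hFc0 : F c ≠ 0 := norm_ne_zero_iff.1 (by rw [h1]; exact one_ne_zero)
  have hre : ∀ w ∈ Metric.closedBall (F c) (1 / 2), 0 < (w / F c).re := fun w hw => by
    have h2 : ‖w / F c - 1‖ ≤ 1 / 2 := by
      rw [div_sub_one hFc0, norm_div, h1, div_one]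
      exact mem_closedBall_iff_norm.1 hw
    have h3 := (abs_le.1 ((Complex.abs_re_le_norm _).trans h2)).1
    rw [Complex.sub_re, Complex.one_re] at h3
    linarith
  have hJ : ContinuousOn (fun w => Complex.log (w / F c)) (Metric.closedBall (F c) (1 / 2)) :=
    ContinuousOn.clog (by fun_prop) fun w hw => Or.inl (hre w hw)
  -- With `|θ z - θ c| < 1 < π` the principal logarithm of `F z / F c` recovers `θ z - θ c` without
  -- a jump by `2π`.
  have hW : θ ⁻¹' Metric.ball (θ c) 1 ∈ 𝓝 c :=
    (hθ.continuousAt hL).preimage_mem_nhds (Metric.ball_mem_nhds _ one_pos)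
  obtain ⟨R, hR, hBL, hBW, -, hPB, hlim⟩ := hP.exists_ball_comp hF hL hW one_half_pos hJ
  -- `toDisc` only rescales by a positive real, so the argument is that of `P n / F c`, whose
  -- logarithm is holomorphic.
  have hscale : ∀ w : ℂ, toDisc (ofComplex w) / F c = (((1 + ‖w‖)⁻¹ : ℝ) : ℂ) * (w / F c) :=
    fun w => by
      simp only [toDisc]
      rw [Complex.ofReal_inv]
      ring
  have him := Complex.uniformContinuous_im.comp_tendstoUniformlyOn hlim
  have hβ : TendstoUniformlyOn (fun n z => (Complex.log ((P n).eval z / F c)).im)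
      (fun z => θ z - θ c) atTop (Metric.ball c R) := by
    refine (him.congr_right fun z hz => ?_).congr (Eventually.of_forall fun n z hz => ?_)
    · have hb : |θ z - θ c| < 1 := by simpa [Real.dist_eq] using hBW hz
      rw [abs_lt] at hb
      have hpi := Real.pi_gt_three
      have hdiv : F z / F c = Complex.exp ((θ z - θ c : ℝ) * Complex.I) := by
        rw [hFθ z (hBL hz), hFθ c hcL, ← Complex.exp_sub]
        push_cast
        ring_nf
      simp only [Function.comp_apply]
      rw [hdiv, Complex.log_exp] <;> simp <;> linarith
    · simp only [Function.comp_apply]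
      rw [hscale, Complex.log_im, Complex.log_im, Complex.arg_real_mul _ (by positivity)]
  have hharm := harmonicAt_of_tendstoUniformlyOn_im hR (by
    filter_upwards [hPB] with n hn
    refine DifferentiableOn.clog ((P n).differentiable.differentiableOn.div_const _)
      fun z hz => Or.inl ?_
    have h2 := hre _ (hn z hz)
    rw [hscale, Complex.re_ofReal_mul] at h2
    exact (mul_pos_iff_of_pos_left (by positivity)).1 h2) hβ
  convert hharm.add (InnerProductSpace.harmonicAt_const (θ c)) using 1
  ext z
  simp

end PolynomialLimit

theorem isometry_toDisc : Isometry toDisc := Isometry.of_dist_eq fun _ _ => rfl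

/-- A uniform limit of polynomials on a set that can be contracted into its interior is of finite
or of infinite type. -/
theorem IsUniformLimitOfPolynomials.isFiniteType_or_isInfiniteType {L : Set ℂ} {z₀ : ℂ}
    {f : L → CircleCompactification} (hL : IsCompact L) (hz₀ : z₀ ∈ interior L)
    (h : ∀ z ∈ L, ∀ t : ℝ, 0 ≤ t → t < 1 → z₀ + t * (z - z₀) ∈ interior L)
    (hf : IsUniformLimitOfPolynomials L f) : IsFiniteType L f ∨ IsInfiniteType L f := by
  classical
  obtain ⟨P, hP⟩ := hf
  let F : ℂ → ℂ := fun z => if hz : z ∈ L then toDisc (f ⟨z, hz⟩) else 0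
  have hFf : ∀ z : L, F z = toDisc (f z) := fun z => by simp [F]
  have hPF : TendstoUniformlyOn (fun n z => toDisc (ofComplex ((P n).eval z))) F atTop L := by
    refine Metric.tendstoUniformlyOn_iff.2 fun ε hε => ?_
    filter_upwards [Metric.tendstoUniformly_iff.1 hP ε hε] with n hn z hz
    rw [hFf ⟨z, hz⟩]
    exact hn ⟨z, hz⟩
  have hpc : ∀ n, Continuous fun z : ℂ => toDisc (ofComplex ((P n).eval z)) := fun n => by
    simp only [toDisc]
    refine (P n).continuous.div (by fun_prop) fun z => ?_
    exact_mod_cast (by positivity : (1 + ‖(P n).eval z‖ : ℝ) ≠ 0)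
  have hFc : ContinuousOn F L :=
    hPF.continuousOn (Frequently.of_forall fun n => (hpc n).continuousOn)
  have hfc : Continuous f := by
    rw [← isometry_toDisc.comp_continuous_iff]
    exact (continuousOn_iff_continuous_domRestrict.1 hFc).congr hFf
  have hF1 : ∀ z ∈ L, ‖F z‖ ≤ 1 := fun z hz => by
    rw [hFf ⟨z, hz⟩]
    exact norm_toDisc_le_one _
  have hnhds : ∀ z ∈ interior L, L ∈ 𝓝 z := fun z hz => mem_interior_iff_mem_nhds.1 hz
  let A : Set ℂ := {z | z ∈ interior L ∧ ‖F z‖ < 1}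
  let B : Set ℂ := {z | z ∈ interior L ∧ ‖F z‖ = 1}
  have hA : IsOpen A := isOpen_iff_mem_nhds.2 fun z hz =>
    inter_mem (isOpen_interior.mem_nhds hz.1)
      ((hFc.continuousAt (hnhds z hz.1)).norm.eventually_lt_const hz.2)
  have hB : IsOpen B := isOpen_iff_mem_nhds.2 fun z hz =>
    inter_mem (isOpen_interior.mem_nhds hz.1)
      (eventually_norm_eq_one hPF hFc hF1 (hnhds z hz.1) hz.2)
  have hconn : IsPreconnected (interior L) :=
    ((starConvex_interior_of_add_real_mul_mem_interior h).isPathConnected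
      hz₀).isConnected.isPreconnected
  have hcover : interior L ⊆ A ∪ B := fun z hz =>
    (hF1 z (interior_subset hz)).lt_or_eq.imp (fun h => ⟨hz, h⟩) fun h => ⟨hz, h⟩
  have hdisj : interior L ∩ (A ∩ B) = ∅ :=
    Set.eq_empty_of_forall_notMem fun z hz => hz.2.1.2.ne hz.2.2.2
  rcases isPreconnected_iff_subset_of_disjoint.1 hconn A B hA hB hcover hdisj with hsub | hsub
  · refine Or.inl ⟨hfc, fun z => F z / ((1 - ‖F z‖ : ℝ) : ℂ), fun z hz => ?_, fun z hz => ?_⟩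
    · exact (differentiableAt_of_norm_lt_one hPF hFc (hnhds z hz)
        (hsub hz).2).differentiableWithinAt
    · have h1 := (hsub hz).2
      rw [hFf] at h1
      simp only [hFf]
      exact eq_ofComplex_of_norm_toDisc_lt_one h1
  -- So far this is known in the interior; each point of `L` is a limit of its contractions, which
  -- are interior.
  · have hone : ∀ z ∈ L, ‖F z‖ = 1 := by
      intro z hz
      have hline : Tendsto (fun t : ℝ => z₀ + t * (z - z₀)) (𝓝[<] 1) (𝓝[L] z) := by
        refine tendsto_nhdsWithin_iff.2 ⟨?_, ?_⟩
        · have : Tendsto (fun t : ℝ => z₀ + t * (z - z₀)) (𝓝 1) (𝓝 (z₀ + (1 : ℝ) * (z - z₀))) :=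
            (by fun_prop : Continuous fun t : ℝ => z₀ + t * (z - z₀)).tendsto 1
          rw [Complex.ofReal_one, one_mul, add_sub_cancel] at this
          exact this.mono_left nhdsWithin_le_nhds
        · filter_upwards [Ioo_mem_nhdsLT (zero_lt_one (α := ℝ))] with t ht
          exact interior_subset (h z hz t ht.1.le ht.2)
      refine tendsto_nhds_unique (((hFc z hz).tendsto.comp hline).norm) ?_
      refine tendsto_const_nhds.congr' ?_
      filter_upwards [Ioo_mem_nhdsLT (zero_lt_one (α := ℝ))] with t ht
      exact (hsub (h z hz t ht.1.le ht.2)).2.symm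
    obtain ⟨θ, hθc, hFθ⟩ := (starConvex_of_add_real_mul_mem_interior h).exists_continuousOn_arg hL
      (interior_subset hz₀) hFc hone
    refine Or.inr ⟨hfc, θ, hθc, fun z hz => harmonicAt_arg hPF hFc (hnhds z hz) hθc hFθ,
      fun z => toDisc_injective ?_⟩
    rw [← hFf, hFθ z z.2]
    simp [toDisc]

end CircleCompactification

theorem proposition6p1 (L : Set ℂ) (hL : IsCompact L) (z₀ : ℂ) (hz₀ : z₀ ∈ interior L)
    (hstar : ∀ ζ ∈ frontier L, segment ℝ z₀ ζ \ {ζ} ⊆ interior L)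
    (f : L → CircleCompactification) :
    CircleCompactification.IsUniformLimitOfPolynomials L f ↔
      CircleCompactification.IsFiniteType L f ∨ CircleCompactification.IsInfiniteType L f := by
  have h : ∀ z ∈ L, ∀ t : ℝ, 0 ≤ t → t < 1 → z₀ + t * (z - z₀) ∈ interior L :=
    fun z hz t h0 h1 => add_real_mul_mem_interior hL hz₀ hstar hz h0 h1
  refine ⟨fun hf => hf.isFiniteType_or_isInfiniteType hL hz₀ h, ?_⟩
  rintro (hf | hf)
  · exact hf.isUniformLimitOfPolynomials hL (interior_subset hz₀) h
  · exact hf.isUniformLimitOfPolynomials hL (interior_subset hz₀) h
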